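/- Let $d\ge 3$, let $Q=[0,1]^d\subset\mathbb R^d$, let $\mathbb R^d$ carry the $\ell^\infty$-norm, and let $\sigma(z)=\max\{z,0\}$. The tree-like function spaces $\mathcal W^L(Q)$ of ReLU networks with $L$ hidden layers are defined recursively as follows. $\mathcal W^0(Q)$ is the space of affine functions $f(x)=w^Tx+b$ on $Q$ with the norm $\|f\|_{\mathcal W^0}=|w|_{\ell^1}+|b|$. Given $\mathcal W^{L}(Q)$ with closed unit ball $B^{L}$ (equipped with the Borel $\sigma$-algebra of the uniform topology), $\mathcal W^{L+1}(Q)$ consists of all continuous $f$ on $Q$ of the form $f(x)=\int_{B^{L}}\sigma(g(x))\,\mu(\mathrm dg)$ for all $x\in Q$ with a finite signed measure $\mu$ on $B^{L}$, and $\|f\|_{\mathcal W^{L+1}}$ is the infimum of the total variations $\|\mu\|$ over all such $\mu$. Let $X=\mathcal W^L(Q)$, let $Y=C^{0,1}(Q)$ with the norm $\|\phi\|_Y=\sup_{x\in Q}|\phi(x)|+\sup_{x\ne y}\frac{|\phi(x)-\phi(y)|}{|x-y|_{\ell^\infty}}$, let $Z=L^2(Q)$ with respect to Lebesgue measure, and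 let $$\rho(t)=\sup_{\|\phi\|_Y\le 1}\ \inf_{\|f\|_X\le t}\ \|\phi-f\|_{L^2(Q)} .$$ Then there is a constant $\bar c_d>0$ depending only on $d$ such that for all $L\ge 0$ and all $t\ge 2^{-L/2}$ $$\rho(t)\ \ge\ \bar c_d\,2^{-\frac{L}{d-2}}\,t^{-\frac{2}{d-2}} .$$ -/

import Mathlib

open MeasureTheory Set
open scoped ENNReal

noncomputable section

namespace TreeWidth

/-- The Kolmogorov width `w_δ(F; G) = sup_{g ∈ G} inf_{f ∈ F} δ(f, g)` of the class `F` in the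
class `G` with respect to the (extended real valued) distance `δ`. -/
def kolmogorovWidth {α : Type*} (δ : α → α → ℝ≥0∞) (F G : Set α) : ℝ≥0∞ :=
  ⨆ g ∈ G, ⨅ f ∈ F, δ f g

/-- The unit cube `Q = [0,1]^d` in `ℝ^d`. The type `Fin d → ℝ` carries the `ℓ^∞` metric and
Lebesgue measure. -/
def cube (d : ℕ) : Set (Fin d → ℝ) := Set.Icc 0 1

/-- The ReLU activation function. -/
def relu (z : ℝ) : ℝ := max z 0

/-- Continuous functions on `K` carry the Borel σ-algebra of the topology of uniform convergence
on compact sets (for compact `K`: the topology of the sup norm). -/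
instance continuousMapBorel {d : ℕ} (K : Set (Fin d → ℝ)) : MeasurableSpace C(K, ℝ) := borel _

/-- The norm of the space `W^0(K)` of affine functions (networks without hidden layers): the
infimum of `|w|_{ℓ^1} + |b|` over all representations `f(x) = wᵀx + b` on `K`, and `∞` if `f` is
not affine on `K`. -/
def affineNorm {d : ℕ} (K : Set (Fin d → ℝ)) (f : C(K, ℝ)) : ℝ≥0∞ :=
  ⨅ (w : Fin d → ℝ) (b : ℝ) (_ : ∀ x : K, f x = ∑ i, w i * x.1 i + b),
    ENNReal.ofReal (∑ i, |w i| + |b|)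

/-- The function `f_μ(x) = ∫ σ(g(x)) μ(dg)` (`σ` the ReLU) represented by a finite signed measure
`μ` on a set `B` of continuous functions; the integral against `μ = μ⁺ - μ⁻` is the difference of
the integrals against the two parts of the Jordan decomposition. -/
def reluSuperposition {d : ℕ} {K : Set (Fin d → ℝ)} (B : Set C(K, ℝ)) (μ : SignedMeasure B)
    (x : K) : ℝ :=
  (∫ g : B, relu (g.1 x) ∂μ.toJordanDecomposition.posPart) -
    ∫ g : B, relu (g.1 x) ∂μ.toJordanDecomposition.negPart

/-- The norm of the generalized Barron space modelled on the space with norm `N` (and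
`N g = ∞` for `g` outside of the space): the infimum of the total variation `‖μ‖` over all signed
measures `μ` on the closed unit ball `{N ≤ 1}` with `f = f_μ` on `K`, where `inf ∅ = ∞`. -/
def barronNorm {d : ℕ} (K : Set (Fin d → ℝ)) (N : C(K, ℝ) → ℝ≥0∞) (f : C(K, ℝ)) : ℝ≥0∞ :=
  ⨅ (μ : SignedMeasure {g : C(K, ℝ) | N g ≤ 1})
    (_ : ∀ x : K, f x = reluSuperposition {g : C(K, ℝ) | N g ≤ 1} μ x),
    μ.totalVariation Set.univ

/-- The norm of the tree-like function space `W^L(K)` of ReLU networks with `L` hidden layers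
(with the value `∞` outside of `W^L(K)`): `W^0(K)` consists of the affine functions, and
`W^{L+1}(K)` is the generalized Barron space modelled on `W^L(K)`. -/
def treeNorm {d : ℕ} (K : Set (Fin d → ℝ)) : ℕ → C(K, ℝ) → ℝ≥0∞
  | 0 => affineNorm K
  | L + 1 => barronNorm K (treeNorm K L)

/-- The closed ball of radius `t` in `W^L(K)`. -/
def treeBall {d : ℕ} (K : Set (Fin d → ℝ)) (L : ℕ) (t : ℝ) : Set C(K, ℝ) :=
  {f | treeNorm K L f ≤ ENNReal.ofReal t}

/-- The norm `sup |f| + sup_{x ≠ y} |f x - f y| / |x - y|_{ℓ^∞}` of `C^{0,1}(K)` (with the value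
`∞` if `f` is not a bounded Lipschitz function). -/
def lipNorm {d : ℕ} (K : Set (Fin d → ℝ)) (f : C(K, ℝ)) : ℝ≥0∞ :=
  (⨆ x : K, ‖f x‖ₑ) + ⨆ (x : K) (y : K) (_ : x ≠ y), edist (f x) (f y) / edist x y

/-- The closed unit ball of `C^{0,1}(K)`. -/
def lipUnitBall {d : ℕ} (K : Set (Fin d → ℝ)) : Set C(K, ℝ) := {f | lipNorm K f ≤ 1}

/-- The distance of `L²(K)` (with respect to Lebesgue measure on `K`). -/
def distL2 {d : ℕ} (K : Set (Fin d → ℝ)) (f g : C(K, ℝ)) : ℝ≥0∞ :=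
  eLpNorm (fun x : K => f x - g x) 2 (Measure.comap Subtype.val volume)

/-- The width `ρ(t) = w_{d_Z}(B^X_t, B^Y_1)` for `X = W^L(Q)`, `Y = C^{0,1}(Q)` and
`Z = L²(Q)`, where `Q = [0,1]^d`. -/
def treeWidth (d L : ℕ) (t : ℝ) : ℝ≥0∞ :=
  kolmogorovWidth (distL2 (cube d)) (treeBall (cube d) L t) (lipUnitBall (cube d))

end TreeWidth

end

/-! Rademacher complexity separates the two classes. At N = m^d points, functions in the ball of
radius t of W^L correlate with random signs by at most t √(2^L (d+1) N) on average
(`sum_signSum_tree_le`). A function in the Lipschitz unit ball can follow any sign pattern on the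
grid of mesh 1/m with height 1/(16 m), a correlation of N/(16 m) (`le_sign_mul_signedBump`). Once
m^(d-2) ≥ 1024 (d+1) 2^L t², the first quantity is at most half the second, so some bump stays at
distance of order 1/m from the ball. Integrating over a common offset of the grid turns this
pointwise statement into one about L¹, hence L². Taking m of the least admissible order gives the
rate.

The dependence on L requires the complexity to grow by √2, not 2, per layer. Therefore the second
moment of the positive part is tracked. Contraction by the ReLU is free for the convex function
(x⁺)² (`exists_selection_reluOn`), and passing to signed measures costs only a factor 2, since x² =
(x⁺)² + ((-x)⁺)² (`sum_sq_signSum_relu_le`). Suprema inside the average are encoded by choosing one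
element per sign pattern. -/

namespace TreeWidth

/-! ### Inequalities for the squared positive part -/

lemma relu_nonneg (x : ℝ) : 0 ≤ relu x := le_max_right _ _

lemma relu_mono : Monotone relu := fun _ _ h => max_le_max_right 0 h

lemma relu_of_nonneg {x : ℝ} (h : 0 ≤ x) : relu x = x := max_eq_left h

lemma relu_of_nonpos {x : ℝ} (h : x ≤ 0) : relu x = 0 := max_eq_right h

lemma abs_relu_le (x : ℝ) : |relu x| ≤ |x| := by
  rw [abs_of_nonneg (relu_nonneg x)]
  exact max_le (le_abs_self x) (abs_nonneg x)

lemma relu_sq_mono {x y : ℝ} (h : x ≤ y) : relu x ^ 2 ≤ relu y ^ 2 :=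
  pow_le_pow_left₀ (relu_nonneg x) (relu_mono h) 2

lemma relu_sq_add_relu_neg_sq (x : ℝ) : relu x ^ 2 + relu (-x) ^ 2 = x ^ 2 := by
  rcases le_total 0 x with h | h
  · rw [relu_of_nonneg h, relu_of_nonpos (by linarith : -x ≤ 0)]; ring
  · rw [relu_of_nonpos h, relu_of_nonneg (by linarith : 0 ≤ -x)]; ring

lemma relu_sq_le_sq {x y : ℝ} (h : |x| ≤ y) : relu x ^ 2 ≤ y ^ 2 :=
  pow_le_pow_left₀ (relu_nonneg x)
    ((le_abs_self _).trans ((abs_relu_le x).trans h)) 2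

/-- Midpoint convexity of (x⁺)²: the ReLU is convex, and squaring is convex and increasing on
nonnegative reals. -/
lemma two_mul_relu_sq_le (a s : ℝ) : 2 * relu a ^ 2 ≤ relu (a + s) ^ 2 + relu (a - s) ^ 2 := by
  have h : 2 * relu a ≤ relu (a + s) + relu (a - s) := by
    rcases le_total 0 a with ha | ha
    · rw [relu_of_nonneg ha]
      have h1 : a + s ≤ relu (a + s) := le_max_left _ _
      have h2 : a - s ≤ relu (a - s) := le_max_left _ _
      linarith
    · rw [relu_of_nonpos ha]
      have := relu_nonneg (a + s)
      have := relu_nonneg (a - s)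
      linarith
  nlinarith [relu_nonneg a, sq_nonneg (relu (a + s) - relu (a - s))]

/-- The two-point comparison behind the contraction principle: removing the ReLU from one
coordinate increases one of the four possible pairings. -/
lemma relu_sq_pair_le (a b s r : ℝ) :
    relu (a + relu s) ^ 2 + relu (b - relu r) ^ 2 ≤ relu (a + s) ^ 2 + relu (b - r) ^ 2 ∨
    relu (a + relu s) ^ 2 + relu (b - relu r) ^ 2 ≤ relu (b + r) ^ 2 + relu (a - s) ^ 2 ∨
    relu (a + relu s) ^ 2 + relu (b - relu r) ^ 2 ≤ relu (a + s) ^ 2 + relu (a - s) ^ 2 ∨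
    relu (a + relu s) ^ 2 + relu (b - relu r) ^ 2 ≤ relu (b + r) ^ 2 + relu (b - r) ^ 2 := by
  rcases le_total 0 s with hs | hs <;> rcases le_total 0 r with hr | hr
  · left; rw [relu_of_nonneg hs, relu_of_nonneg hr]
  · left; rw [relu_of_nonneg hs, relu_of_nonpos hr]
    have := relu_sq_mono (by linarith : b - 0 ≤ b - r)
    linarith
  · right; left; rw [relu_of_nonpos hs, relu_of_nonneg hr]
    have h1 := relu_sq_mono (by linarith : a + 0 ≤ a - s)
    have h2 := relu_sq_mono (by linarith : b - r ≤ b + r)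
    linarith
  · rw [relu_of_nonpos hs, relu_of_nonpos hr, add_zero, sub_zero]
    -- Both ReLUs vanish: replace the smaller of `a`, `b` by the larger and use convexity, with the
    -- same vector in both slots.
    rcases le_total a b with h | h
    · right; right; right
      have := relu_sq_mono h
      have := two_mul_relu_sq_le b r
      linarith
    · right; right; left
      have := relu_sq_mono h
      have := two_mul_relu_sq_le a s
      linarith

/-- Flip the sign with index `i`. -/
def flipSign {ι : Type*} [DecidableEq ι] (i : ι) (ε : ι → ℤˣ) : ι → ℤˣ := Function.update ε i (-ε i)

lemma flipSign_involutive {ι : Type*} [DecidableEq ι] (i : ι) : Function.Involutive (flipSign i) := by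
  intro ε
  simp [flipSign]

/-! ### Rademacher sums and the contraction principle -/

section Rademacher

variable {ι : Type*} [Fintype ι]

/-- The Rademacher sum `∑ εᵢ vᵢ`. -/
noncomputable def signSum (ε : ι → ℤˣ) (v : ι → ℝ) : ℝ := ∑ i, ((ε i : ℤ) : ℝ) * v i

lemma signSum_neg (ε : ι → ℤˣ) (v : ι → ℝ) : signSum (-ε) v = -signSum ε v := by
  simp [signSum, Finset.sum_neg_distrib]

variable [DecidableEq ι]

lemma sum_flipSign (i : ι) (F : (ι → ℤˣ) → ℝ) : ∑ ε, F (flipSign i ε) = ∑ ε, F ε :=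
  Equiv.sum_comp (flipSign_involutive i).toPerm F

/-- Flipping the sign `i` negates every summand and permutes the sign patterns. -/
lemma sum_sign_mul_sign {i j : ι} (h : i ≠ j) :
    ∑ ε : ι → ℤˣ, ((ε i : ℤ) : ℝ) * ((ε j : ℤ) : ℝ) = 0 := by
  have := sum_flipSign i (fun ε : ι → ℤˣ => ((ε i : ℤ) : ℝ) * ((ε j : ℤ) : ℝ))
  simp only [flipSign, Function.update_self, Function.update_of_ne h.symm, Units.val_neg,
    Int.cast_neg, neg_mul, Finset.sum_neg_distrib] at this
  linarith

lemma sign_mul_self (u : ℤˣ) : ((u : ℤ) : ℝ) * ((u : ℤ) : ℝ) = 1 := by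
  rcases Int.units_eq_one_or u with h | h <;> simp [h]

lemma sum_signSum_sq (v : ι → ℝ) :
    ∑ ε : ι → ℤˣ, signSum ε v ^ 2 = Fintype.card (ι → ℤˣ) * ∑ i, v i ^ 2 := by
  have h (ε : ι → ℤˣ) : signSum ε v ^ 2 =
      ∑ i, ∑ j, (v i * v j) * (((ε i : ℤ) : ℝ) * ((ε j : ℤ) : ℝ)) := by
    rw [signSum, sq, Finset.sum_mul_sum]
    refine Finset.sum_congr rfl fun i _ => Finset.sum_congr rfl fun j _ => by ring
  simp only [h]
  rw [Finset.sum_comm, Finset.mul_sum]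
  refine Finset.sum_congr rfl fun i _ => ?_
  rw [Finset.sum_comm, Finset.sum_eq_single i]
  · simp only [sign_mul_self, Finset.sum_const, Finset.card_univ, nsmul_eq_mul]; ring
  · intro j _ hj
    rw [← Finset.mul_sum, sum_sign_mul_sign hj.symm, mul_zero]
  · simp

/-- Apply the ReLU to the coordinates in `S`. -/
noncomputable def reluOn (S : Finset ι) (v : ι → ℝ) : ι → ℝ :=
  fun i => if i ∈ S then relu (v i) else v i

/-- The part of the Rademacher sum of `reluOn S v` that does not involve the coordinate `i`. -/
noncomputable def signRest (S : Finset ι) (i : ι) (ε : ι → ℤˣ) (v : ι → ℝ) : ℝ :=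
  ∑ j ∈ Finset.univ.erase i, ((ε j : ℤ) : ℝ) * reluOn S v j

lemma signRest_flipSign (S : Finset ι) (i : ι) (ε : ι → ℤˣ) (v : ι → ℝ) :
    signRest S i (flipSign i ε) v = signRest S i ε v := by
  refine Finset.sum_congr rfl fun j hj => ?_
  rw [flipSign, Function.update_of_ne (Finset.ne_of_mem_erase hj)]

lemma signSum_reluOn {S : Finset ι} {i : ι} (hi : i ∉ S) (ε : ι → ℤˣ) (v : ι → ℝ) :
    signSum ε (reluOn S v) = signRest S i ε v + ((ε i : ℤ) : ℝ) * v i := by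
  rw [signSum, ← Finset.sum_erase_add _ _ (Finset.mem_univ i), signRest]
  simp [reluOn, hi]

lemma signSum_reluOn_insert (S : Finset ι) (i : ι) (ε : ι → ℤˣ) (v : ι → ℝ) :
    signSum ε (reluOn (insert i S) v) = signRest S i ε v + ((ε i : ℤ) : ℝ) * relu (v i) := by
  rw [signSum, ← Finset.sum_erase_add _ _ (Finset.mem_univ i), signRest]
  congr 1
  · refine Finset.sum_congr rfl fun j hj => ?_
    simp [reluOn, Finset.ne_of_mem_erase hj]
  · simp [reluOn]

/-- Flipping the sign `i` leaves the rest of the sum unchanged, so only the two-point comparison is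
needed. Its four cases are the four ways of assigning `v` or `w` to the two slots. -/
lemma exists_pair_relu_sq_le {T : Set (ι → ℝ)} {S : Finset ι} {i : ι} (hi : i ∉ S)
    {ε : ι → ℤˣ} (hε : ε i = 1) {v w : ι → ℝ} (hv : v ∈ T) (hw : w ∈ T) :
    ∃ v' ∈ T, ∃ w' ∈ T,
      relu (signSum ε (reluOn (insert i S) v)) ^ 2 +
        relu (signSum (flipSign i ε) (reluOn (insert i S) w)) ^ 2 ≤
      relu (signSum ε (reluOn S v')) ^ 2 + relu (signSum (flipSign i ε) (reluOn S w')) ^ 2 := by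
  have hflip : flipSign i ε i = -1 := by simp [flipSign, hε]
  simp only [signSum_reluOn_insert, signSum_reluOn hi, signRest_flipSign, hflip, hε]
  simp only [Units.val_one, Int.cast_one, one_mul, Units.val_neg, Int.cast_neg, neg_mul,
    ← sub_eq_add_neg]
  rcases relu_sq_pair_le (signRest S i ε v) (signRest S i ε w) (v i) (w i) with h | h | h | h
  · exact ⟨v, hv, w, hw, h⟩
  · exact ⟨w, hw, v, hv, h⟩
  · exact ⟨v, hv, v, hv, h⟩
  · exact ⟨w, hw, w, hw, h⟩

/-- The contraction principle for Rademacher sums and the convex function `x ↦ (x⁺)²`, phrased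
with selections from `T` instead of suprema over `T`. -/
lemma exists_selection_reluOn (T : Set (ι → ℝ)) (S : Finset ι) :
    ∀ u : (ι → ℤˣ) → ι → ℝ, (∀ ε, u ε ∈ T) → ∃ u' : (ι → ℤˣ) → ι → ℝ, (∀ ε, u' ε ∈ T) ∧
      ∑ ε, relu (signSum ε (reluOn S (u ε))) ^ 2 ≤ ∑ ε, relu (signSum ε (u' ε)) ^ 2 := by
  induction S using Finset.induction_on with
  | empty => exact fun u hu => ⟨u, hu, le_rfl⟩
  | insert i S hi ih =>
    intro u hu
    have key (ε : ι → ℤˣ) : ∃ v' ∈ T, ∃ w' ∈ T, ε i = 1 →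
        relu (signSum ε (reluOn (insert i S) (u ε))) ^ 2 +
          relu (signSum (flipSign i ε) (reluOn (insert i S) (u (flipSign i ε)))) ^ 2 ≤
        relu (signSum ε (reluOn S v')) ^ 2 +
          relu (signSum (flipSign i ε) (reluOn S w')) ^ 2 := by
      by_cases hε : ε i = 1
      · obtain ⟨v, hv, w, hw, h⟩ := exists_pair_relu_sq_le hi hε (hu ε) (hu (flipSign i ε))
        exact ⟨v, hv, w, hw, fun _ => h⟩
      · exact ⟨u ε, hu ε, u ε, hu ε, fun h => absurd h hε⟩
    choose V hV W hW hVW using key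
    -- Patterns are paired by the flip; each pair is handled from its member with `ε i = 1`, and the
    -- other member receives the second chosen vector.
    let u₁ : (ι → ℤˣ) → ι → ℝ := fun ε => if ε i = 1 then V ε else W (flipSign i ε)
    have hu₁ : ∀ ε, u₁ ε ∈ T := by
      intro ε
      by_cases hε : ε i = 1
      · simpa [u₁, hε] using hV ε
      · simpa [u₁, hε] using hW (flipSign i ε)
    obtain ⟨u', hu', hle⟩ := ih u₁ hu₁
    refine ⟨u', hu', le_trans ?_ hle⟩
    let G' : (ι → ℤˣ) → ℝ := fun ε => relu (signSum ε (reluOn (insert i S) (u ε))) ^ 2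
    let G : (ι → ℤˣ) → ℝ := fun ε => relu (signSum ε (reluOn S (u₁ ε))) ^ 2
    have pos (ε : ι → ℤˣ) (hε : ε i = 1) : G' ε + G' (flipSign i ε) ≤ G ε + G (flipSign i ε) := by
      have h1 : u₁ ε = V ε := if_pos hε
      have h2 : u₁ (flipSign i ε) = W ε := by
        have : ¬ flipSign i ε i = 1 := by simp [flipSign, hε]
        simp only [u₁, if_neg this, flipSign_involutive i ε]
      simpa only [G', G, h1, h2] using hVW ε hε
    have all (ε : ι → ℤˣ) : G' ε + G' (flipSign i ε) ≤ G ε + G (flipSign i ε) := by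
      rcases Int.units_eq_one_or (ε i) with hε | hε
      · exact pos ε hε
      · have := pos (flipSign i ε) (by simp [flipSign, hε])
        rw [flipSign_involutive i ε] at this
        linarith
    -- Summing over all patterns counts each pair twice on both sides.
    have := Finset.sum_le_sum fun ε (_ : ε ∈ Finset.univ) => all ε
    rw [Finset.sum_add_distrib, Finset.sum_add_distrib, sum_flipSign i G', sum_flipSign i G] at this
    change ∑ ε, G' ε ≤ ∑ ε, G ε
    linarith

lemma sum_relu_sq_signSum_relu_le {T : Set (ι → ℝ)} {A : ℝ}
    (hA : ∀ u : (ι → ℤˣ) → ι → ℝ, (∀ ε, u ε ∈ T) → ∑ ε, relu (signSum ε (u ε)) ^ 2 ≤ A)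
    (u : (ι → ℤˣ) → ι → ℝ) (hu : ∀ ε, u ε ∈ T) :
    ∑ ε, relu (signSum ε fun i => relu (u ε i)) ^ 2 ≤ A := by
  obtain ⟨u', hu', h⟩ := exists_selection_reluOn T Finset.univ u hu
  refine le_trans (le_of_eq (Finset.sum_congr rfl fun ε _ => ?_)) (h.trans (hA u' hu'))
  rw [show reluOn Finset.univ (u ε) = fun i => relu (u ε i) from
    funext fun i => if_pos (Finset.mem_univ i)]

/-- The square splits into the positive parts of the sum and of its negative; the substitution ε ↦
-ε reduces the latter to the former. This is the source of the factor 2 per layer. -/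
lemma sum_sq_signSum_relu_le {T : Set (ι → ℝ)} {A : ℝ}
    (hA : ∀ u : (ι → ℤˣ) → ι → ℝ, (∀ ε, u ε ∈ T) → ∑ ε, relu (signSum ε (u ε)) ^ 2 ≤ A)
    (u : (ι → ℤˣ) → ι → ℝ) (hu : ∀ ε, u ε ∈ T) :
    ∑ ε, (signSum ε fun i => relu (u ε i)) ^ 2 ≤ 2 * A := by
  have h1 := sum_relu_sq_signSum_relu_le hA u hu
  have h2 := sum_relu_sq_signSum_relu_le hA (fun ε => u (-ε)) fun ε => hu (-ε)
  rw [← Equiv.sum_comp (Equiv.neg (ι → ℤˣ))] at h2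
  simp only [Equiv.neg_apply, neg_neg, signSum_neg] at h2
  rw [← Finset.sum_congr rfl fun ε _ => relu_sq_add_relu_neg_sq _, Finset.sum_add_distrib]
  linarith

end Rademacher

/-! ### Rademacher complexity of balls in the tree-like spaces -/

/-- The norms are infima that need not be attained; this removes the slack η of a near-optimal
representation. -/
lemma le_mul_of_forall_pos_le_add_mul {x t K : ℝ} (h : ∀ η > 0, x ≤ (t + η) * K) :
    x ≤ t * K := by
  have hlim : Filter.Tendsto (fun η : ℝ => (t + η) * K) (nhdsWithin 0 (Ioi 0)) (nhds (t * K)) := by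
    have : Filter.Tendsto (fun η : ℝ => (t + η) * K) (nhds 0) (nhds ((t + 0) * K)) :=
      ((continuous_const.add continuous_id).mul continuous_const).tendsto 0
    rw [add_zero] at this
    exact this.mono_left nhdsWithin_le_nhds
  exact ge_of_tendsto hlim (Filter.eventually_of_mem self_mem_nhdsWithin fun η hη => h η hη)

section Balls

variable {d : ℕ} {K : Set (Fin d → ℝ)}

lemma measurable_relu_eval (B : Set C(K, ℝ)) (x : K) :
    Measurable fun g : B => relu (g.1 x) := by
  have : BorelSpace C(K, ℝ) := ⟨rfl⟩
  have h : Measurable fun g : C(K, ℝ) => g x := (continuous_eval_const x).measurable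
  exact (h.comp measurable_subtype_coe).max measurable_const

/-- Linear functionals of point evaluations on the ball of a generalized Barron space. -/
lemma abs_sum_le_of_barronNorm_le {N : C(K, ℝ) → ℝ≥0∞}
    (hB : ∀ g, N g ≤ 1 → ∀ x, |g x| ≤ 1) {ι : Type*} [Fintype ι] (p : ι → K) (c : ι → ℝ)
    {M : ℝ} (hM0 : 0 ≤ M) (hM : ∀ g, N g ≤ 1 → |∑ i, c i * relu (g (p i))| ≤ M)
    {f : C(K, ℝ)} {t : ℝ} (ht : 0 ≤ t) (hf : barronNorm K N f ≤ ENNReal.ofReal t) :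
    |∑ i, c i * f (p i)| ≤ t * M := by
  refine le_mul_of_forall_pos_le_add_mul fun η hη => ?_
  have hlt : barronNorm K N f < ENNReal.ofReal (t + η) :=
    hf.trans_lt ((ENNReal.ofReal_lt_ofReal_iff (by linarith)).2 (by linarith))
  simp only [barronNorm, iInf_lt_iff] at hlt
  obtain ⟨μ, hμ, hTV⟩ := hlt
  have hint (ν : Measure {g : C(K, ℝ) | N g ≤ 1}) [IsFiniteMeasure ν] (x : K) :
      Integrable (fun g : {g : C(K, ℝ) | N g ≤ 1} => relu (g.1 x)) ν :=
    Integrable.of_bound (measurable_relu_eval _ x).aestronglyMeasurable 1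
      (ae_of_all _ fun g => (abs_relu_le _).trans (hB g.1 g.2 x))
  have hsum (ν : Measure {g : C(K, ℝ) | N g ≤ 1}) [IsFiniteMeasure ν] :
      |∑ i, c i * ∫ g, relu (g.1 (p i)) ∂ν| ≤ M * ν.real univ := by
    have : ∑ i, c i * ∫ g, relu (g.1 (p i)) ∂ν =
        ∫ g : {g : C(K, ℝ) | N g ≤ 1}, ∑ i, c i * relu (g.1 (p i)) ∂ν := by
      rw [integral_finsetSum _ fun i _ => (hint ν (p i)).const_mul (c i)]
      simp only [integral_const_mul]
    rw [this]
    exact norm_integral_le_of_norm_le_const (f := fun g : {g : C(K, ℝ) | N g ≤ 1} =>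
      ∑ i, c i * relu (g.1 (p i))) (ae_of_all ν fun g => hM g.1 g.2)
  have hsplit : ∑ i, c i * f (p i) =
      ∑ i, c i * ∫ g, relu (g.1 (p i)) ∂μ.toJordanDecomposition.posPart -
        ∑ i, c i * ∫ g, relu (g.1 (p i)) ∂μ.toJordanDecomposition.negPart := by
    rw [← Finset.sum_sub_distrib]
    exact Finset.sum_congr rfl fun i _ => by rw [hμ, reluSuperposition, mul_sub]
  have hTV' : μ.toJordanDecomposition.posPart.real univ +
      μ.toJordanDecomposition.negPart.real univ ≤ t + η := by
    rw [SignedMeasure.totalVariation, Measure.add_apply] at hTV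
    rw [measureReal_def, measureReal_def,
      ← ENNReal.toReal_add (measure_ne_top _ _) (measure_ne_top _ _)]
    exact ENNReal.toReal_le_of_le_ofReal (by linarith) hTV.le
  rw [hsplit]
  refine (abs_sub _ _).trans ?_
  have h1 := hsum μ.toJordanDecomposition.posPart
  have h2 := hsum μ.toJordanDecomposition.negPart
  nlinarith

/-- Linear functionals of point evaluations on the ball of the space of affine functions. -/
lemma abs_sum_le_of_affineNorm_le {ι : Type*} [Fintype ι] (p : ι → K) (c : ι → ℝ)
    {M : ℝ} (hM : ∀ k, |∑ i, c i * (p i).1 k| ≤ M) (hM' : |∑ i, c i| ≤ M)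
    {f : C(K, ℝ)} {t : ℝ} (ht : 0 ≤ t) (hf : affineNorm K f ≤ ENNReal.ofReal t) :
    |∑ i, c i * f (p i)| ≤ t * M := by
  refine le_mul_of_forall_pos_le_add_mul fun η hη => ?_
  have hlt : affineNorm K f < ENNReal.ofReal (t + η) :=
    hf.trans_lt ((ENNReal.ofReal_lt_ofReal_iff (by linarith)).2 (by linarith))
  simp only [affineNorm, iInf_lt_iff] at hlt
  obtain ⟨w, b, hwb, hlt⟩ := hlt
  have hw : ∑ k, |w k| + |b| ≤ t + η := ((ENNReal.ofReal_lt_ofReal_iff (by linarith)).1 hlt).le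
  have h0 : 0 ≤ M := (abs_nonneg _).trans hM'
  have heq : ∑ i, c i * f (p i) = ∑ k, w k * ∑ i, c i * (p i).1 k + b * ∑ i, c i := by
    simp only [hwb, mul_add, Finset.sum_add_distrib, Finset.mul_sum]
    congr 1
    · rw [Finset.sum_comm]
      exact Finset.sum_congr rfl fun k _ => Finset.sum_congr rfl fun i _ => by ring
    · exact Finset.sum_congr rfl fun i _ => by ring
  rw [heq]
  calc _ ≤ ∑ k, |w k * ∑ i, c i * (p i).1 k| + |b * ∑ i, c i| :=
        (abs_add_le _ _).trans (add_le_add_left (Finset.abs_sum_le_sum_abs _ _) _)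
    _ ≤ ∑ k, |w k| * M + |b| * M := by
        simp only [abs_mul]
        gcongr with k
        exact hM k
    _ = (∑ k, |w k| + |b|) * M := by rw [← Finset.sum_mul, add_mul]
    _ ≤ _ := by gcongr

lemma zero_mem_treeBall (L : ℕ) (t : ℝ) : (0 : C(K, ℝ)) ∈ treeBall K L t := by
  change treeNorm K L 0 ≤ _
  refine le_trans (b := 0) ?_ bot_le
  cases L with
  | zero => exact iInf_le_of_le 0 (iInf_le_of_le 0 (iInf_le_of_le (by simp) (by simp)))
  | succ L =>
    refine iInf_le_of_le 0 (iInf_le_of_le (fun x => ?_) (le_of_eq ?_))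
    · simp [reluSuperposition, SignedMeasure.toJordanDecomposition_zero]
    · simp [SignedMeasure.totalVariation_zero]

/-- One-point case of the bounds on functionals. It supplies the integrability needed in the next
layer. -/
lemma abs_le_of_mem_treeBall (hK : K ⊆ cube d) (L : ℕ) :
    ∀ {t : ℝ}, 0 ≤ t → ∀ {f : C(K, ℝ)}, f ∈ treeBall K L t → ∀ x, |f x| ≤ t := by
  induction L with
  | zero =>
    intro t ht f hf x
    have hx := hK x.2
    have := abs_sum_le_of_affineNorm_le (fun _ : Unit => x) (fun _ => 1) (M := 1)
      (fun k => by simpa [abs_le] using ⟨by linarith [hx.1 k, show (0 : Fin d → ℝ) k = 0 from rfl], hx.2 k⟩)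
      (by simp) ht hf
    simpa using this
  | succ L ih =>
    intro t ht f hf x
    have hB : ∀ g, treeNorm K L g ≤ 1 → ∀ x, |g x| ≤ 1 := fun g hg =>
      ih zero_le_one (by simpa [treeBall] using hg)
    have := abs_sum_le_of_barronNorm_le hB (fun _ : Unit => x) (fun _ => 1) zero_le_one
      (fun g hg => by simpa using (abs_relu_le _).trans (hB g hg x)) ht hf
    simpa using this

variable {ι : Type*} [Fintype ι]

/-- Duality: a linear functional on the ball is controlled by its values on the generators σ ∘ g.
The slack η is there because the supremum over g need not be attained. -/
lemma exists_relu_sq_signSum_le (hK : K ⊆ cube d) (L : ℕ) {t : ℝ} (ht : 0 < t) (p : ι → K)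
    (ε : ι → ℤˣ) {f : C(K, ℝ)} (hf : f ∈ treeBall K (L + 1) t) {η : ℝ} (hη : 0 < η) :
    ∃ g ∈ treeBall K L 1, relu (signSum ε fun i => f (p i)) ^ 2 ≤
      t ^ 2 * ((signSum ε fun i => relu (g (p i))) ^ 2 + η) := by
  by_contra! hcon
  have hmem : ∀ g, treeNorm K L g ≤ 1 → g ∈ treeBall K L 1 := fun g hg => by
    simpa [treeBall] using hg
  set X := signSum ε fun i => f (p i)
  -- If the claim fails, every generator has squared sum below `R`, so `|X| ≤ t * √R`, which
  -- contradicts the choice of `R`. Nonnegativity of `R` comes from the generator 0.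
  set R := relu X ^ 2 / t ^ 2 - η
  have hR : t ^ 2 * R = relu X ^ 2 - t ^ 2 * η := by
    simp only [R]; field_simp
  have hlt : ∀ g ∈ treeBall K L 1, (signSum ε fun i => relu (g (p i))) ^ 2 < R := fun g hg =>
    lt_of_mul_lt_mul_left (by rw [hR]; linarith [hcon g hg]) (sq_nonneg t)
  have hR0 : 0 ≤ R := (sq_nonneg _).trans (hlt 0 (zero_mem_treeBall L 1)).le
  have h : |X| ≤ t * √R := abs_sum_le_of_barronNorm_le
    (fun g hg x => abs_le_of_mem_treeBall hK L zero_le_one (hmem g hg) x) p _ (Real.sqrt_nonneg R)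
    (fun g hg => Real.abs_le_sqrt (hlt g (hmem g hg)).le) ht.le hf
  have h2 := relu_sq_le_sq h
  rw [mul_pow, Real.sq_sqrt hR0, hR] at h2
  have : 0 < t ^ 2 * η := by positivity
  linarith

variable [DecidableEq ι]

/-- The Rademacher second moment of the affine functions of norm at most `t`. -/
lemma sum_relu_sq_signSum_affine_le (hK : K ⊆ cube d) {t : ℝ} (ht : 0 ≤ t) (p : ι → K)
    (f : (ι → ℤˣ) → C(K, ℝ)) (hf : ∀ ε, affineNorm K (f ε) ≤ ENNReal.ofReal t) :
    ∑ ε, relu (signSum ε fun i => f ε (p i)) ^ 2 ≤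
      t ^ 2 * ((d + 1) * Fintype.card ι * Fintype.card (ι → ℤˣ)) := by
  -- The ℓ¹ norm of (w, b) is dual to the maximum of d + 1 functionals; bounding this maximum by a
  -- root of the sum of squares produces the factor d + 1.
  have hpt (ε : ι → ℤˣ) : relu (signSum ε fun i => f ε (p i)) ^ 2 ≤
      t ^ 2 * (∑ k, signSum ε (fun i => (p i).1 k) ^ 2 + signSum ε (fun _ => 1) ^ 2) := by
    set R := ∑ k, signSum ε (fun i => (p i).1 k) ^ 2 + signSum ε (fun _ => 1) ^ 2 with hR
    have hR0 : 0 ≤ ∑ k, signSum ε (fun i => (p i).1 k) ^ 2 := Finset.sum_nonneg fun _ _ => sq_nonneg _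
    have h := abs_sum_le_of_affineNorm_le p (fun i => ((ε i : ℤ) : ℝ)) (M := √R)
      (fun k => Real.abs_le_sqrt <| by
        have : signSum ε (fun i => (p i).1 k) ^ 2 ≤ ∑ k, signSum ε (fun i => (p i).1 k) ^ 2 :=
          Finset.single_le_sum (f := fun k => signSum ε (fun i => (p i).1 k) ^ 2)
            (fun _ _ => sq_nonneg _) (Finset.mem_univ k)
        exact this.trans (le_add_of_nonneg_right (sq_nonneg _)))
      (Real.abs_le_sqrt <| by
        have : signSum ε (fun _ => 1) ^ 2 ≤ R := le_add_of_nonneg_left hR0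
        simpa [signSum] using this) ht (hf ε)
    refine (relu_sq_le_sq h).trans (le_of_eq ?_)
    rw [mul_pow, Real.sq_sqrt (add_nonneg hR0 (sq_nonneg _))]
  refine (Finset.sum_le_sum fun ε _ => hpt ε).trans ?_
  rw [← Finset.mul_sum, Finset.sum_add_distrib, Finset.sum_comm]
  simp only [sum_signSum_sq]
  have hle (k : Fin d) : ∑ i, (p i).1 k ^ 2 ≤ Fintype.card ι := by
    refine (Finset.sum_le_sum fun i _ => ?_).trans_eq (by simp : ∑ _i : ι, (1 : ℝ) = _)
    exact pow_le_one₀ ((hK (p i).2).1 k) ((hK (p i).2).2 k)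
  have : ∑ k : Fin d, (Fintype.card (ι → ℤˣ) : ℝ) * ∑ i, (p i).1 k ^ 2 ≤
      d * (Fintype.card (ι → ℤˣ) * Fintype.card ι) := by
    refine (Finset.sum_le_sum fun k _ => mul_le_mul_of_nonneg_left (hle k) (Nat.cast_nonneg _)).trans_eq ?_
    simp
  refine mul_le_mul_of_nonneg_left ?_ (sq_nonneg t)
  simp only [one_pow, Finset.sum_const, Finset.card_univ, nsmul_eq_mul, mul_one] at this ⊢
  linarith

/-- The Rademacher second moment of the ball of radius `t` in the tree-like function space. -/
theorem sum_relu_sq_signSum_tree_le (hK : K ⊆ cube d) (p : ι → K) (L : ℕ) :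
    ∀ {t : ℝ}, 0 < t → ∀ f : (ι → ℤˣ) → C(K, ℝ), (∀ ε, f ε ∈ treeBall K L t) →
    ∑ ε, relu (signSum ε fun i => f ε (p i)) ^ 2 ≤
      t ^ 2 * (2 ^ L * ((d + 1) * Fintype.card ι * Fintype.card (ι → ℤˣ))) := by
  induction L with
  | zero =>
    intro t ht f hf
    simpa using sum_relu_sq_signSum_affine_le hK ht.le p f hf
  | succ L ih =>
    intro t ht f hf
    set D : ℝ := (d + 1) * Fintype.card ι * Fintype.card (ι → ℤˣ)
    have hT : ∀ u : (ι → ℤˣ) → ι → ℝ,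
        (∀ ε, u ε ∈ (fun g : C(K, ℝ) => fun i => g (p i)) '' treeBall K L 1) →
        ∑ ε, relu (signSum ε (u ε)) ^ 2 ≤ 2 ^ L * D := by
      intro u hu
      choose g hg hgu using hu
      simpa [← hgu] using ih one_pos g hg
    have hη : ∀ η > 0, ∑ ε, relu (signSum ε fun i => f ε (p i)) ^ 2 ≤
        t ^ 2 * (2 * (2 ^ L * D)) + η := by
      intro η hη
      have hcard : (0 : ℝ) < Fintype.card (ι → ℤˣ) := by exact_mod_cast Fintype.card_pos
      have hη' : 0 < η / (t ^ 2 * Fintype.card (ι → ℤˣ)) := by positivity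
      choose g hg hgf using fun ε => exists_relu_sq_signSum_le hK L ht p ε (hf ε) hη'
      have h := sum_sq_signSum_relu_le hT (fun ε i => g ε (p i)) fun ε => mem_image_of_mem _ (hg ε)
      refine (Finset.sum_le_sum fun ε _ => hgf ε).trans ?_
      rw [← Finset.mul_sum, Finset.sum_add_distrib, mul_add]
      refine add_le_add (mul_le_mul_of_nonneg_left h (sq_nonneg t)) (le_of_eq ?_)
      rw [Finset.sum_const, Finset.card_univ, nsmul_eq_mul]
      field_simp
    refine (le_of_forall_pos_le_add hη).trans_eq ?_
    ring

/-- The Rademacher complexity of the ball of radius `t` in the tree-like function space. -/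
theorem sum_signSum_tree_le (hK : K ⊆ cube d) (p : ι → K) (L : ℕ) {t : ℝ} (ht : 0 < t)
    (f : (ι → ℤˣ) → C(K, ℝ)) (hf : ∀ ε, f ε ∈ treeBall K L t) :
    ∑ ε, signSum ε (fun i => f ε (p i)) ≤
      Fintype.card (ι → ℤˣ) * (t * √(2 ^ L * ((d + 1) * Fintype.card ι))) := by
  have h1 : ∑ ε, signSum ε (fun i => f ε (p i)) ≤ ∑ ε, relu (signSum ε fun i => f ε (p i)) :=
    Finset.sum_le_sum fun ε _ => le_max_left _ _
  refine h1.trans (le_of_abs_le (abs_le_of_sq_le_sq ?_ (by positivity)))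
  have h2 := sum_relu_sq_signSum_tree_le hK p L ht f hf
  -- Cauchy–Schwarz passes from the second moment to the first.
  have h3 := sq_sum_le_card_mul_sum_sq (s := Finset.univ)
    (f := fun ε : ι → ℤˣ => relu (signSum ε fun i => f ε (p i)))
  rw [Finset.card_univ] at h3
  refine h3.trans ((mul_le_mul_of_nonneg_left h2 (Nat.cast_nonneg _)).trans_eq ?_)
  rw [mul_pow, mul_pow, Real.sq_sqrt (by positivity)]
  ring

end Balls

/-! ### Lipschitz bumps with prescribed signs on a grid -/

lemma lipNorm_le_one {d : ℕ} {K : Set (Fin d → ℝ)} {f : C(K, ℝ)} (h1 : ∀ x, |f x| ≤ 1 / 2)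
    (h2 : ∀ x y, |f x - f y| ≤ 1 / 2 * dist x y) : lipNorm K f ≤ 1 := by
  have hhalf : ENNReal.ofReal (1 / 2) + ENNReal.ofReal (1 / 2) = 1 := by
    rw [← ENNReal.ofReal_add (by norm_num) (by norm_num)]; norm_num
  rw [lipNorm, ← hhalf]
  refine add_le_add (iSup_le fun x => ?_) (iSup_le fun x => iSup_le fun y => iSup_le fun _ => ?_)
  · rw [Real.enorm_eq_ofReal_abs]
    exact ENNReal.ofReal_le_ofReal (h1 x)
  · refine ENNReal.div_le_of_le_mul ?_
    rw [edist_dist, edist_dist, ← ENNReal.ofReal_mul (by norm_num)]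
    exact ENNReal.ofReal_le_ofReal (h2 x y)

section Bumps

variable {d m : ℕ}

/-- The centre of a cell of the grid which divides the unit cube into `m ^ d` cells. -/
noncomputable def cellCenter (k : Fin d → Fin m) : Fin d → ℝ := fun j => ((k j : ℝ) + 1 / 2) / m

/-- The centres of the cells with sign `s`, and a point far away from the unit cube. -/
noncomputable def signedCenters (ε : (Fin d → Fin m) → ℤˣ) (s : ℤˣ) : Set (Fin d → ℝ) :=
  insert (fun _ => 10) (cellCenter '' {k | ε k = s})

/-- The distance to the centres with sign `s`, truncated at half the side length of a cell. -/
noncomputable def truncDist (ε : (Fin d → Fin m) → ℤˣ) (s : ℤˣ) (x : Fin d → ℝ) : ℝ :=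
  min (1 / (2 * m)) (Metric.infDist x (signedCenters ε s))

/-- A Lipschitz function with a bump of sign `ε k` in the cell `k` for every `k`. -/
noncomputable def signedBump (ε : (Fin d → Fin m) → ℤˣ) : C(cube d, ℝ) where
  toFun x := (truncDist ε (-1) x.1 - truncDist ε 1 x.1) / 4
  continuous_toFun := by
    have h (s : ℤˣ) : Continuous fun x : cube d => truncDist ε s x.1 :=
      continuous_const.min ((Metric.continuous_infDist_pt _).comp continuous_subtype_val)
    exact ((h _).sub (h _)).div_const 4

lemma signedBump_apply (ε : (Fin d → Fin m) → ℤˣ) (x : cube d) :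
    signedBump ε x = (truncDist ε (-1) x.1 - truncDist ε 1 x.1) / 4 := rfl

lemma truncDist_nonneg (ε : (Fin d → Fin m) → ℤˣ) (s : ℤˣ) (x : Fin d → ℝ) :
    0 ≤ truncDist ε s x := le_min (by positivity) Metric.infDist_nonneg

lemma truncDist_le_one (hm : 0 < m) (ε : (Fin d → Fin m) → ℤˣ) (s : ℤˣ) (x : Fin d → ℝ) :
    truncDist ε s x ≤ 1 := by
  have h1 : (1 : ℝ) ≤ m := by exact_mod_cast hm
  refine (min_le_left _ _).trans ?_
  rw [div_le_one (by linarith)]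
  linarith

lemma abs_truncDist_sub_le (ε : (Fin d → Fin m) → ℤˣ) (s : ℤˣ) (x y : Fin d → ℝ) :
    |truncDist ε s x - truncDist ε s y| ≤ dist x y := by
  refine (abs_min_sub_min_le_max _ _ _ _).trans (max_le (by simp) ?_)
  have := (Metric.lipschitz_infDist_pt (signedCenters ε s)).dist_le_mul x y
  simpa [Real.dist_eq] using this

/-- Each truncated distance is 1-Lipschitz with values in [0, 1], so a quarter of their difference
has Lipschitz constant at most 1/2 and modulus at most 1/4. -/
lemma signedBump_mem_lipUnitBall (hm : 0 < m) (ε : (Fin d → Fin m) → ℤˣ) :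
    signedBump ε ∈ lipUnitBall (cube d) := by
  refine lipNorm_le_one (fun x => ?_) fun x y => ?_
  · rw [signedBump_apply, abs_le]
    have h1 := truncDist_nonneg ε 1 x.1
    have h2 := truncDist_nonneg ε (-1) x.1
    have h3 := truncDist_le_one hm ε 1 x.1
    have h4 := truncDist_le_one hm ε (-1) x.1
    constructor <;> linarith
  · have h1 := abs_le.1 (abs_truncDist_sub_le ε 1 x.1 y.1)
    have h2 := abs_le.1 (abs_truncDist_sub_le ε (-1) x.1 y.1)
    rw [signedBump_apply, signedBump_apply, Subtype.dist_eq, abs_le]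
    constructor <;> linarith [h1.1, h1.2, h2.1, h2.2]

lemma inv_le_dist_cellCenter (hm : 0 < m) {k l : Fin d → Fin m} (h : k ≠ l) :
    1 / (m : ℝ) ≤ dist (cellCenter k) (cellCenter l) := by
  obtain ⟨j, hj⟩ := Function.ne_iff.1 h
  refine le_trans ?_ (dist_le_pi_dist (cellCenter k) (cellCenter l) j)
  have hm' : (0 : ℝ) < m := by exact_mod_cast hm
  rw [Real.dist_eq, cellCenter, cellCenter, ← sub_div, abs_div, abs_of_pos hm']
  refine div_le_div_of_nonneg_right ?_ hm'.le
  have hz : (1 : ℤ) ≤ |((k j : ℕ) : ℤ) - ((l j : ℕ) : ℤ)| := by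
    refine Int.one_le_abs (sub_ne_zero.2 fun h => hj (Fin.ext ?_))
    exact_mod_cast h
  have hz' : (1 : ℝ) ≤ |((k j : ℕ) : ℝ) - ((l j : ℕ) : ℝ)| := by exact_mod_cast hz
  simpa using hz'

lemma closedBall_cellCenter_subset (hm : 0 < m) (k : Fin d → Fin m) :
    Metric.closedBall (cellCenter k) (1 / (4 * m)) ⊆ cube d := by
  intro x hx
  have hm' : (0 : ℝ) < m := by exact_mod_cast hm
  have hx' (j : Fin d) := abs_le.1 ((dist_le_pi_dist x (cellCenter k) j).trans hx)
  have hk (j : Fin d) : ((k j : ℕ) : ℝ) + 1 ≤ m := by exact_mod_cast (k j).2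
  have hk0 (j : Fin d) : 1 / (2 * m) ≤ cellCenter k j := by
    rw [cellCenter, div_le_div_iff₀ (by positivity) hm']
    nlinarith [Nat.cast_nonneg (α := ℝ) (k j : ℕ)]
  have hk1 (j : Fin d) : cellCenter k j ≤ 1 - 1 / (2 * m) := by
    rw [cellCenter, div_le_iff₀ hm', sub_mul, div_mul_eq_mul_div, mul_div_mul_right _ _ hm'.ne']
    linarith [hk j]
  have hq : 1 / (4 * (m : ℝ)) ≤ 1 / (2 * m) := by
    apply one_div_le_one_div_of_le <;> linarith
  exact ⟨fun j => by simp only [Pi.zero_apply]; linarith [(hx' j).1, hk0 j],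
    fun j => by simp only [Pi.one_apply]; linarith [(hx' j).2, hk1 j]⟩

lemma truncDist_le_of_dist_le {ε : (Fin d → Fin m) → ℤˣ} {k : Fin d → Fin m} {x : Fin d → ℝ}
    (hx : dist x (cellCenter k) ≤ 1 / (4 * m)) : truncDist ε (ε k) x ≤ 1 / (4 * m) :=
  have hmem : cellCenter k ∈ signedCenters ε (ε k) :=
    mem_insert_of_mem _ (mem_image_of_mem cellCenter (show k ∈ {l | ε l = ε k} from rfl))
  (min_le_right _ _).trans ((Metric.infDist_le_dist_of_mem hmem).trans hx)

lemma truncDist_eq_of_dist_le (hd : 0 < d) (hm : 0 < m) {ε : (Fin d → Fin m) → ℤˣ}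
    {k : Fin d → Fin m} {s : ℤˣ} (hs : ε k ≠ s) {x : Fin d → ℝ}
    (hx : dist x (cellCenter k) ≤ 1 / (4 * m)) : truncDist ε s x = 1 / (2 * m) := by
  have hm' : (1 : ℝ) ≤ m := by exact_mod_cast hm
  -- The far point keeps the set nonempty even if no cell has sign `s`; otherwise `Metric.infDist`
  -- would be 0. All other centres in the set are at distance at least 1/m - 1/(4m) from `x`, so the
  -- truncation is active.
  refine min_eq_left ((Metric.le_infDist (insert_nonempty _ _)).2 ?_)
  rintro y (rfl | ⟨l, hl, rfl⟩)
  · refine le_trans ?_ (dist_le_pi_dist x _ ⟨0, hd⟩)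
    have h1 : x ⟨0, hd⟩ ≤ 1 := (closedBall_cellCenter_subset hm k hx).2 ⟨0, hd⟩
    have h2 : 1 / (2 * (m : ℝ)) ≤ 1 := by rw [div_le_one (by linarith)]; linarith
    rw [Real.dist_eq]
    exact h2.trans (le_abs.2 (Or.inr (by linarith)))
  · have hkl : k ≠ l := by rintro rfl; exact hs hl
    have h1 := inv_le_dist_cellCenter hm hkl
    have h2 := dist_triangle_left (cellCenter k) (cellCenter l) x
    have h3 : 1 / (4 * (m : ℝ)) = 1 / m / 4 := by field_simp
    have h4 : 1 / (2 * (m : ℝ)) = 1 / m / 2 := by field_simp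
    have h5 : 0 < 1 / (m : ℝ) := by positivity
    rw [h3] at hx
    rw [h4]
    linarith

lemma le_sign_mul_signedBump (hd : 0 < d) (hm : 0 < m) (ε : (Fin d → Fin m) → ℤˣ)
    (k : Fin d → Fin m) (x : cube d) (hx : dist x.1 (cellCenter k) ≤ 1 / (4 * m)) :
    1 / (16 * (m : ℝ)) ≤ ((ε k : ℤ) : ℝ) * signedBump ε x := by
  have h1 := truncDist_le_of_dist_le (ε := ε) hx
  have hne : ε k ≠ -ε k := fun h => by
    rcases Int.units_eq_one_or (ε k) with h' | h' <;> rw [h'] at h <;> exact absurd h (by decide)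
  have h2 := truncDist_eq_of_dist_le hd hm hne hx
  have h3 : 1 / (16 * (m : ℝ)) = (1 / (2 * m) - 1 / (4 * m)) / 4 := by
    have : (m : ℝ) ≠ 0 := by exact_mod_cast hm.ne'
    field_simp; norm_num
  rw [h3, signedBump_apply]
  rcases Int.units_eq_one_or (ε k) with h | h <;> rw [h] at h1 h2 ⊢
  · rw [h2]; push_cast; linarith
  · rw [neg_neg] at h2
    rw [h2]; push_cast; linarith

end Bumps

/-! ### From point evaluations to integrals over the cube -/

section Integrals

variable {d m : ℕ}

lemma setLIntegral_closedBall_add (c : Fin d → ℝ) (r : ℝ) (U : (Fin d → ℝ) → ℝ≥0∞) :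
    ∫⁻ y in Metric.closedBall 0 r, U (c + y) = ∫⁻ x in Metric.closedBall c r, U x := by
  rw [← lintegral_indicator Metric.isClosed_closedBall.measurableSet,
    ← lintegral_indicator Metric.isClosed_closedBall.measurableSet,
    ← lintegral_add_left_eq_self (indicator _ U) c]
  refine lintegral_congr fun y => ?_
  have : y ∈ Metric.closedBall 0 r ↔ c + y ∈ Metric.closedBall c r := by
    simp [Metric.mem_closedBall, dist_eq_norm]
  by_cases hy : y ∈ Metric.closedBall 0 r
  · rw [indicator_of_mem hy, indicator_of_mem (this.1 hy)]
  · rw [indicator_of_notMem hy, indicator_of_notMem fun h => hy (this.2 h)]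

/-- The balls around the centres are disjoint and lie in the cube, so integrating grid sums over the
common offset `y` is bounded by an integral over the cube. -/
lemma sum_setLIntegral_cell_le (hm : 0 < m) (U : (Fin d → ℝ) → ℝ≥0∞) :
    ∑ k : Fin d → Fin m, ∫⁻ y in Metric.closedBall 0 (1 / (4 * m)), U (cellCenter k + y) ≤
      ∫⁻ x in cube d, U x := by
  simp only [setLIntegral_closedBall_add]
  have hdisj : Pairwise (Function.onFun Disjoint fun k : Fin d → Fin m =>
      Metric.closedBall (cellCenter k) (1 / (4 * (m : ℝ)))) := by
    intro k l hkl
    refine Metric.closedBall_disjoint_closedBall (lt_of_lt_of_le ?_ (inv_le_dist_cellCenter hm hkl))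
    have hm' : (0 : ℝ) < m := by exact_mod_cast hm
    have h3 : 1 / (4 * (m : ℝ)) = 1 / m / 4 := by field_simp
    have h5 : 0 < 1 / (m : ℝ) := by positivity
    rw [h3]; linarith
  rw [← tsum_fintype (L := .unconditional _), ← lintegral_iUnion
    (fun k => Metric.isClosed_closedBall.measurableSet) hdisj]
  exact lintegral_mono_set (iUnion_subset fun k => closedBall_cellCenter_subset hm k)

lemma volume_cube : volume (cube d) = 1 := by
  simp [cube, Real.volume_Icc_pi]

/-- Each ball is a cube of side 1/(2m), so the balls fill a fraction of the unit cube independent of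
`m`. -/
lemma card_mul_volume_cell (hm : 0 < m) :
    (Fintype.card (Fin d → Fin m) : ℝ≥0∞) *
      volume (Metric.closedBall (0 : Fin d → ℝ) (1 / (4 * m))) = ENNReal.ofReal ((1 / 2) ^ d) := by
  have hm' : (0 : ℝ) < m := by exact_mod_cast hm
  rw [Real.volume_pi_closedBall _ (by positivity), Fintype.card_fun, Fintype.card_fin,
    Fintype.card_fin, ← ENNReal.ofReal_natCast, ← ENNReal.ofReal_mul (by positivity)]
  congr 1
  rw [Nat.cast_pow, ← mul_pow]
  congr 1
  field_simp; norm_num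

/-- The nearest point of the unit cube. -/
noncomputable def clampCube (x : Fin d → ℝ) : cube d :=
  ⟨(x ⊔ 0) ⊓ 1, le_inf le_sup_right zero_le_one, inf_le_right⟩

lemma clampCube_of_mem {x : Fin d → ℝ} (hx : x ∈ cube d) : clampCube x = ⟨x, hx⟩ :=
  Subtype.ext (by
    change (x ⊔ 0) ⊓ 1 = x
    rw [sup_eq_left.2 hx.1, inf_eq_left.2 hx.2])

lemma continuous_clampCube : Continuous (clampCube : (Fin d → ℝ) → cube d) :=
  Continuous.subtype_mk (continuous_pi fun j =>
    ((continuous_apply j).max continuous_const).min continuous_const) _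

/-- L¹ is dominated by L² because the cube has measure one; clamping only serves to define the
integrand on all of ℝ^d. -/
lemma setLIntegral_le_distL2 (f g : C(cube d, ℝ)) :
    ∫⁻ x in cube d, ‖f (clampCube x) - g (clampCube x)‖ₑ ≤ distL2 (cube d) f g := by
  have hmeas : MeasurableSet (cube d) := measurableSet_Icc
  have : IsProbabilityMeasure (Measure.comap (Subtype.val : cube d → Fin d → ℝ) volume) := by
    refine ⟨?_⟩
    rw [(MeasurableEmbedding.subtype_coe hmeas).comap_apply, image_univ, Subtype.range_coe,
      volume_cube]
  have hcont : Continuous fun x : cube d => f x - g x := f.continuous.sub g.continuous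
  refine le_trans (le_of_eq ?_) (eLpNorm_le_eLpNorm_of_exponent_le (p := 1) (by norm_num)
    hcont.aestronglyMeasurable)
  rw [eLpNorm_one_eq_lintegral_enorm, ← lintegral_subtype_comap hmeas]
  refine lintegral_congr fun x => ?_
  rw [clampCube_of_mem x.2]

end Integrals

/-! ### The lower bound for the width -/

section Width

variable {d : ℕ}

/-- The signed bumps are on average far from functions in the tree-like function space. -/
lemma le_sum_enorm_sub_signedBump (hd : 0 < d) {m : ℕ} (hm : 0 < m) (L : ℕ) {t : ℝ} (ht : 0 < t)
    (hmt : t * √(2 ^ L * ((d + 1) * m ^ d)) ≤ m ^ d / (32 * m))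
    (f : ((Fin d → Fin m) → ℤˣ) → C(cube d, ℝ)) (hf : ∀ ε, f ε ∈ treeBall (cube d) L t)
    (p : (Fin d → Fin m) → cube d) (hp : ∀ k, dist (p k).1 (cellCenter k) ≤ 1 / (4 * m)) :
    ENNReal.ofReal (Fintype.card ((Fin d → Fin m) → ℤˣ) * (m ^ d / (32 * m))) ≤
      ∑ ε, ∑ k, ‖f ε (p k) - signedBump ε (p k)‖ₑ := by
  have hcard : (Fintype.card (Fin d → Fin m) : ℝ) = m ^ d := by simp
  have h1 := sum_signSum_tree_le subset_rfl p L ht f hf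
  rw [hcard] at h1
  -- The bumps contribute N/(16 m), twice what `hmt` allows the approximants on average, so half
  -- survives.
  have h2 (ε : (Fin d → Fin m) → ℤˣ) :
      2 * ((m : ℝ) ^ d / (32 * m)) ≤ signSum ε fun k => signedBump ε (p k) := by
    refine le_trans (le_of_eq ?_) (Finset.sum_le_sum fun k _ =>
      le_sign_mul_signedBump hd hm ε k (p k) (hp k))
    rw [Finset.sum_const, Finset.card_univ, nsmul_eq_mul, hcard]
    have : (m : ℝ) ≠ 0 := by exact_mod_cast hm.ne'
    field_simp; norm_num
  have h3 (ε : (Fin d → Fin m) → ℤˣ) :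
      (signSum ε fun k => signedBump ε (p k)) - signSum ε (fun k => f ε (p k)) ≤
        ∑ k, |f ε (p k) - signedBump ε (p k)| := by
    rw [signSum, signSum, ← Finset.sum_sub_distrib]
    refine Finset.sum_le_sum fun k _ => ?_
    have habs : |((ε k : ℤ) : ℝ)| = 1 := by
      rcases Int.units_eq_one_or (ε k) with h | h <;> simp [h]
    rw [← mul_sub, abs_sub_comm]
    refine (le_abs_self _).trans_eq ?_
    rw [abs_mul, habs, one_mul]
  simp only [Real.enorm_eq_ofReal_abs]
  simp_rw [← ENNReal.ofReal_sum_of_nonneg fun k (_ : k ∈ Finset.univ) => abs_nonneg _]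
  rw [← ENNReal.ofReal_sum_of_nonneg fun ε _ => Finset.sum_nonneg fun k _ => abs_nonneg _]
  refine ENNReal.ofReal_le_ofReal ?_
  have h4 := Finset.sum_le_sum fun ε (_ : ε ∈ Finset.univ) => h3 ε
  rw [Finset.sum_sub_distrib] at h4
  have h5 := Finset.sum_le_sum fun ε (_ : ε ∈ Finset.univ) => h2 ε
  rw [Finset.sum_const, Finset.card_univ, nsmul_eq_mul] at h5
  have h6 := mul_le_mul_of_nonneg_left hmt
    (Nat.cast_nonneg (α := ℝ) (Fintype.card ((Fin d → Fin m) → ℤˣ)))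
  linarith

/-- A lower bound for the width at the scale of a grid which is fine enough. -/
theorem le_treeWidth_of_grid (hd : 0 < d) {m : ℕ} (hm : 0 < m) (L : ℕ) {t : ℝ} (ht : 0 < t)
    (hmt : t * √(2 ^ L * ((d + 1) * m ^ d)) ≤ m ^ d / (32 * m)) :
    ENNReal.ofReal ((1 / 2) ^ d * (1 / (32 * m))) ≤ treeWidth d L t := by
  refine le_of_forall_gt_imp_ge_of_dense fun δ hδ => ?_
  have hex (ε : (Fin d → Fin m) → ℤˣ) : ∃ f ∈ treeBall (cube d) L t,
      distL2 (cube d) f (signedBump ε) < δ := by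
    have : ⨅ f ∈ treeBall (cube d) L t, distL2 (cube d) f (signedBump ε) < δ :=
      lt_of_le_of_lt (le_iSup₂_of_le (f := fun g (_ : g ∈ lipUnitBall (cube d)) =>
        ⨅ f ∈ treeBall (cube d) L t, distL2 (cube d) f g) (signedBump ε)
        (signedBump_mem_lipUnitBall hm ε) le_rfl) hδ
    simpa only [iInf_lt_iff, exists_prop] using this
  choose f hf hfδ using hex
  let U (ε : (Fin d → Fin m) → ℤˣ) (x : Fin d → ℝ) : ℝ≥0∞ :=
    ‖f ε (clampCube x) - signedBump ε (clampCube x)‖ₑ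
  let D : Set (Fin d → ℝ) := Metric.closedBall 0 (1 / (4 * m))
  have hU (ε : (Fin d → Fin m) → ℤˣ) (k : Fin d → Fin m) :
      Measurable fun y => U ε (cellCenter k + y) :=
    ((((f ε).continuous.comp continuous_clampCube).sub
      ((signedBump ε).continuous.comp continuous_clampCube)).comp
      (continuous_const.add continuous_id)).enorm.measurable
  have hlow : ∀ y ∈ D, ENNReal.ofReal (Fintype.card ((Fin d → Fin m) → ℤˣ) * (m ^ d / (32 * m))) ≤
      ∑ ε, ∑ k : Fin d → Fin m, U ε (cellCenter k + y) := by
    intro y hy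
    refine le_sum_enorm_sub_signedBump hd hm L ht hmt f hf (fun k => clampCube (cellCenter k + y))
      fun k => ?_
    have hmem : cellCenter k + y ∈ Metric.closedBall (cellCenter k) (1 / (4 * (m : ℝ))) := by
      simpa [D, Metric.mem_closedBall, dist_eq_norm] using hy
    rw [clampCube_of_mem (closedBall_cellCenter_subset hm k hmem)]
    exact hmem
  -- Integrating `hlow` over the offset compares the averaged gap with at most `δ` for each sign
  -- pattern; the number of patterns then cancels.
  have hup : ENNReal.ofReal (Fintype.card ((Fin d → Fin m) → ℤˣ) * (m ^ d / (32 * m))) * volume D ≤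
      Fintype.card ((Fin d → Fin m) → ℤˣ) * δ := by
    calc _ = ∫⁻ _ in D, ENNReal.ofReal (Fintype.card ((Fin d → Fin m) → ℤˣ) * (m ^ d / (32 * m))) :=
          (setLIntegral_const _ _).symm
      _ ≤ ∫⁻ y in D, ∑ ε, ∑ k : Fin d → Fin m, U ε (cellCenter k + y) :=
          setLIntegral_mono' Metric.isClosed_closedBall.measurableSet hlow
      _ = ∑ ε, ∑ k : Fin d → Fin m, ∫⁻ y in D, U ε (cellCenter k + y) := by
          rw [lintegral_finsetSum _ fun ε _ => Finset.measurable_sum _ fun k _ => hU ε k]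
          exact Finset.sum_congr rfl fun ε _ => lintegral_finsetSum _ fun k _ => hU ε k
      _ ≤ ∑ _ε : (Fin d → Fin m) → ℤˣ, δ := Finset.sum_le_sum fun ε _ =>
          (sum_setLIntegral_cell_le hm (U ε)).trans
            ((setLIntegral_le_distL2 _ _).trans (hfδ ε).le)
      _ = _ := by rw [Finset.sum_const, Finset.card_univ, nsmul_eq_mul]
  rw [ENNReal.ofReal_mul (Nat.cast_nonneg _), ENNReal.ofReal_natCast, mul_assoc,
    ENNReal.mul_le_mul_iff_right (by exact_mod_cast Fintype.card_ne_zero)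
      (ENNReal.natCast_ne_top _)] at hup
  refine le_trans (le_of_eq ?_) hup
  rw [ENNReal.ofReal_mul (by positivity), ← card_mul_volume_cell hm, Fintype.card_fun,
    Fintype.card_fin, Fintype.card_fin, div_eq_mul_one_div ((m : ℝ) ^ d),
    ENNReal.ofReal_mul (by positivity), ← Nat.cast_pow, ENNReal.ofReal_natCast, mul_right_comm]

end Width

end TreeWidth

/-! ### Choice of the grid size -/

theorem mainTheorem8 (d : ℕ) (hd : 3 ≤ d) :
    ∃ c : ℝ, 0 < c ∧ ∀ (L : ℕ) (t : ℝ), (2 : ℝ) ^ (-(L : ℝ) / 2) ≤ t →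
      ENNReal.ofReal
          (c * (2 : ℝ) ^ (-(L : ℝ) / ((d : ℝ) - 2)) * t ^ (-(2 : ℝ) / ((d : ℝ) - 2))) ≤
        TreeWidth.treeWidth d L t := by
  have hd2 : (0 : ℝ) < (d : ℝ) - 2 := by
    have : (3 : ℝ) ≤ d := by exact_mod_cast hd
    linarith
  have hA : (1 : ℝ) ≤ 1024 * (d + 1) := by nlinarith [Nat.cast_nonneg (α := ℝ) d]
  refine ⟨(1 / 2) ^ d * (1 / 64) * (1024 * (d + 1) : ℝ) ^ (-(1 : ℝ) / (d - 2)), by positivity,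
    fun L t ht => ?_⟩
  have ht0 : 0 < t := (Real.rpow_pos_of_pos two_pos _).trans_le ht
  -- Squaring the grid condition gives m^(d-2) ≥ `B`, with 1024 = 32².
  set B : ℝ := 1024 * (d + 1) * (2 ^ L * t ^ 2) with hB
  -- This is where t ≥ 2^(-L/2) enters: it gives β ≥ 1, so rounding up costs at most a factor 2 and
  -- the 1/32 becomes the 1/64 in the constant.
  have hst : 1 ≤ 2 ^ L * t ^ 2 := by
    have h := pow_le_pow_left₀ (Real.rpow_pos_of_pos two_pos _).le ht 2
    rw [← Real.rpow_natCast, ← Real.rpow_mul two_pos.le] at h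
    have h2 : (2 : ℝ) ^ (-(L : ℝ) / 2 * (2 : ℕ)) = (2 ^ L)⁻¹ := by
      rw [← Real.rpow_natCast, ← Real.rpow_neg two_pos.le]
      congr 1
      push_cast; ring
    rw [h2] at h
    calc (1 : ℝ) = 2 ^ L * (2 ^ L)⁻¹ := by field_simp
      _ ≤ _ := by gcongr
  have hB1 : 1 ≤ B := one_le_mul_of_one_le_of_one_le hA hst
  have hB0 : 0 < B := by linarith
  set β : ℝ := B ^ (1 / ((d : ℝ) - 2)) with hβ
  have hβ1 : 1 ≤ β := Real.one_le_rpow hB1 (by positivity)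
  set m : ℕ := ⌈β⌉₊ with hm
  have hm0 : 0 < m := Nat.ceil_pos.2 (by linarith)
  have hm0' : (0 : ℝ) < m := by exact_mod_cast hm0
  have hβm : β ≤ m := Nat.le_ceil β
  have hmβ : (m : ℝ) ≤ 2 * β := by linarith [Nat.ceil_lt_add_one (show 0 ≤ β by linarith)]
  have hBm : B * m ^ 2 ≤ m ^ d := by
    have h1 : B = β ^ (d - 2) := by
      rw [hβ, ← Real.rpow_natCast, ← Real.rpow_mul hB0.le, Nat.cast_sub (by omega)]
      push_cast
      rw [one_div_mul_cancel hd2.ne', Real.rpow_one]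
    calc B * (m : ℝ) ^ 2 ≤ (m : ℝ) ^ (d - 2) * m ^ 2 := by rw [h1]; gcongr
      _ = (m : ℝ) ^ d := by rw [← pow_add]; congr 1; omega
  have hmt : t * √(2 ^ L * ((d + 1) * m ^ d)) ≤ m ^ d / (32 * m) := by
    rw [le_div_iff₀ (by positivity)]
    refine le_of_abs_le (abs_le_of_sq_le_sq ?_ (by positivity))
    calc (t * √(2 ^ L * ((d + 1) * m ^ d)) * (32 * m)) ^ 2
        = B * m ^ 2 * (m : ℝ) ^ d := by
          rw [mul_pow, mul_pow, Real.sq_sqrt (by positivity), hB]; ring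
      _ ≤ (m : ℝ) ^ d * (m : ℝ) ^ d := by gcongr
      _ = _ := by ring
  refine le_trans (ENNReal.ofReal_le_ofReal ?_)
    (TreeWidth.le_treeWidth_of_grid (by omega) hm0 L ht0 hmt)
  have hrate : (1024 * (d + 1) : ℝ) ^ (-(1 : ℝ) / (d - 2)) * 2 ^ (-(L : ℝ) / (d - 2)) *
      t ^ (-(2 : ℝ) / (d - 2)) = β⁻¹ := by
    rw [hβ, ← Real.rpow_neg hB0.le, hB,
      Real.mul_rpow (zero_le_one.trans hA) (zero_le_one.trans hst),
      Real.mul_rpow (pow_nonneg two_pos.le L) (sq_nonneg t), ← Real.rpow_natCast_mul two_pos.le,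
      ← Real.rpow_natCast_mul ht0.le, mul_assoc, Nat.cast_ofNat, ← neg_div, mul_div_assoc',
      mul_div_assoc', mul_neg_one, mul_neg_one]
  calc _ = (1 / 2) ^ d * (1 / 64) * β⁻¹ := by rw [← hrate]; ring
    _ = (1 / 2) ^ d * (1 / (32 * (2 * β))) := by field_simp; norm_num
    _ ≤ _ := by gcongr
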